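/- **Definitions.** Let $V$ be a finite set. A *DCG* on $V$ is a directed graph $G$ on $V$ without self-loops, directed cycles (including $j\to k\to j$) being allowed. A vertex $j$ is an *ancestor* of $k$ if there is a directed path $j\to\cdots\to k$ with at least one edge, and $\mathrm{an}(S)$ is the set of vertices that are in $S$ or are ancestors of a vertex of $S$. For $j\neq k$ and $S\subseteq V\setminus\{j,k\}$, $j$ and $k$ are *d-connected* given $S$ if there is an undirected path in $G$ (a sequence of consecutive edges, visiting no vertex twice) from $j$ to $k$ such that every collider $\to b\leftarrow$ on it is in $\mathrm{an}(S)$ and every interior non-collider on it is not in $S$; otherwise they are *d-separated* given $S$. $D_{sep}(G)$ is the set of all triples $(j,k,S)$ such that $j$ is d-separated from $k$ given $S$. Distinct vertices $j,k$ form an edge of the *skeleton* $S(G)$ if they are really adjacent ($j\to k$ or $k\to j$) or virtually adjacent (they have a common child that is an ancestor of $j$ or of $k$); $|S(G)|$ is the number of unordered pairs in $S(G)$. Let $\mathbb P$ be the distribution of a real random vector $(X_v)_{v\in V}$; the pair $(G,\mathbb P)$ is a *DCG model*. - $(G,\mathbb P)$ satisfies the *CMC* if $X_j\perp X_k\mid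 X_S$ under $\mathbb P$ for every $(j,k,S)\in D_{sep}(G)$, and the *CFC* if for all $j\ne k$ and $S\subseteq V\setminus\{j,k\}$: $(j,k,S)\in D_{sep}(G)\iff X_j\perp X_k\mid X_S$ under $\mathbb P$. - $G_1,G_2$ are *Markov equivalent* if exactly the same distributions satisfy the CMC with respect to $G_1$ and to $G_2$; $\mathcal M(G)$ is the set of DCGs on $V$ Markov equivalent to $G$. - $(G,\mathbb P)$ satisfies the *identifiable SMR* (resp. *weak SMR*, or frugality) assumption if it satisfies the CMC and $|S(G)|<|S(G')|$ (resp. $|S(G)|\le|S(G')|$) for every DCG $G'$ on $V$ such that $(G',\mathbb P)$ satisfies the CMC and $G'\notin\mathcal M(G)$. - $(G,\mathbb P)$ satisfies the *P-minimality* assumption if it satisfies the CMC and there is no DCG $G'\notin\mathcal M(G)$ on $V$ such that $(G',\mathbb P)$ satisfies the CMC and $D_{sep}(G)\subsetneq D_{sep}(G')$. - $(G,\mathbb P)$ is a *Gaussian linear DCG model* if $\mathbb P$ is the law of the solution of $X=B^{T}X+\epsilon$ with $\epsilon\sim\mathcal N(0,I)$, where $I-B^T$ is invertible and $B_{jk}\ne0$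 if and only if $j\to k$ in $G$. **Theorem.** (a) For every finite $V$, every DCG model on $V$ that satisfies the CFC satisfies the weak SMR assumption. (b) There is a Gaussian linear DCG model $(G,\mathbb P)$ on 5 vertices, where $G$ has a directed cycle, that satisfies the CFC but not the identifiable SMR assumption. (c) For every finite $V$, every DCG model on $V$ that satisfies the identifiable SMR assumption satisfies the P-minimality assumption. (d) There is a Gaussian linear DCG model $(G,\mathbb P)$ on 5 vertices, where $G$ has a directed cycle, that satisfies the weak SMR assumption but not the P-minimality assumption. -/

import Mathlib

open MeasureTheory ProbabilityTheory

noncomputable section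

/-- A directed (possibly cyclic) graph on the vertex set `V`: a set of directed edges between
distinct vertices; `G.Adj j k` means `j → k`. Both `j → k` and `k → j` may be present. -/
structure DCG (V : Type*) extends Digraph V where
  irrefl : ∀ v, ¬ Adj v v

namespace DCG

variable {V : Type*}

/-- There is a directed path `j → ⋯ → k` with at least one edge. -/
def IsAncestor (G : DCG V) (j k : V) : Prop := Relation.TransGen G.Adj j k

/-- `G` has a directed cycle. -/
def HasDirectedCycle (G : DCG V) : Prop := ∃ v, G.IsAncestor v v

/-- `an(S)`: the vertices that are in `S` or are ancestors of a vertex of `S`. -/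
def an (G : DCG V) (S : Finset V) : Set V := {v | ∃ s ∈ S, v = s ∨ G.IsAncestor v s}

/-- A sequence of consecutive directed edges, each traversed forwards or backwards. The edges are
part of the data, since `a → b` and `a ← b` may both be present. -/
inductive Trail (G : DCG V) : V → V → Type _
  | nil (a : V) : Trail G a a
  | fwd {a b c : V} (h : G.Adj a b) (p : Trail G b c) : Trail G a c
  | bwd {a b c : V} (h : G.Adj b a) (p : Trail G b c) : Trail G a c

namespace Trail

variable {G : DCG V}

/-- The list of vertices visited. -/
def vertices : {a b : V} → Trail G a b → List V
  | _, _, .nil a => [a]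
  | a, _, .fwd _ p => a :: p.vertices
  | a, _, .bwd _ p => a :: p.vertices

/-- Every collider of the trail is in `an(S)` and every (interior) non-collider is not in `S`.
A collider is an interior vertex `b` met as `→ b ←`. -/
def Active (S : Finset V) : {a b : V} → Trail G a b → Prop
  | _, _, .nil _ => True
  | _, _, .fwd _ (.nil _) => True
  | _, _, .bwd _ (.nil _) => True
  | _, _, .fwd (b := b) _ (.fwd h p) => b ∉ S ∧ Active S (.fwd h p)
  | _, _, .fwd (b := b) _ (.bwd h p) => b ∈ G.an S ∧ Active S (.bwd h p)
  | _, _, .bwd (b := b) _ (.fwd h p) => b ∉ S ∧ Active S (.fwd h p)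
  | _, _, .bwd (b := b) _ (.bwd h p) => b ∉ S ∧ Active S (.bwd h p)

end Trail

/-- `j` and `k` are d-connected given `S`: some undirected path between them (no vertex is
repeated) d-connects them given `S`. -/
def DConnected (G : DCG V) (j k : V) (S : Finset V) : Prop :=
  ∃ π : Trail G j k, π.vertices.Nodup ∧ π.Active S

/-- The set of d-separation rules entailed by `G`: the triples `(j, k, S)` with `j ≠ k` and
`S ⊆ V \ {j, k}` such that `j` is d-separated from `k` given `S`. -/
def Dsep (G : DCG V) : Set (V × V × Finset V) :=
  {t | t.1 ≠ t.2.1 ∧ t.1 ∉ t.2.2 ∧ t.2.1 ∉ t.2.2 ∧ ¬ G.DConnected t.1 t.2.1 t.2.2}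

/-- Real adjacency: `j → k` or `j ← k`. -/
def ReallyAdjacent (G : DCG V) (j k : V) : Prop := G.Adj j k ∨ G.Adj k j

/-- Virtual adjacency: `j` and `k` have a common child that is an ancestor of `j` or of `k`. -/
def VirtuallyAdjacent (G : DCG V) (j k : V) : Prop :=
  ∃ l, G.Adj j l ∧ G.Adj k l ∧ (G.IsAncestor l j ∨ G.IsAncestor l k)

/-- The skeleton `S(G)`: the undirected graph of real and virtual edges. -/
def skeleton (G : DCG V) : SimpleGraph V where
  Adj j k := j ≠ k ∧ (G.ReallyAdjacent j k ∨ G.VirtuallyAdjacent j k)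
  symm := ⟨by
    rintro j k ⟨hne, h | ⟨l, hj, hk, h⟩⟩
    · exact ⟨hne.symm, Or.inl h.symm⟩
    · exact ⟨hne.symm, Or.inr ⟨l, hk, hj, h.symm⟩⟩⟩
  loopless := ⟨fun _ h => h.1 rfl⟩

/-- `|S(G)|`: the total number of (real or virtual) edges. -/
def skeletonCard (G : DCG V) : ℕ := G.skeleton.edgeSet.ncard

variable [Fintype V]

/-- `X_j` and `X_k` are conditionally independent given `X_S` under the distribution `P` of the
random vector `X = (X_v)`, `v ∈ V`. -/
def CondIndepCoord (P : ProbabilityMeasure (V → ℝ)) (j k : V) (S : Finset V) : Prop :=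
  CondIndepFun (MeasurableSpace.comap (fun (x : V → ℝ) (i : S) => x i) inferInstance)
    (Measurable.comap_le (measurable_pi_lambda _ fun i => measurable_pi_apply (i : V)))
    (fun x : V → ℝ => x j) (fun x : V → ℝ => x k) (P : Measure (V → ℝ))

/-- The causal Markov condition for `(G, P)`. -/
def CMC (G : DCG V) (P : ProbabilityMeasure (V → ℝ)) : Prop :=
  ∀ j k S, (j, k, S) ∈ G.Dsep → CondIndepCoord P j k S

/-- The causal faithfulness condition for `(G, P)`. -/
def CFC (G : DCG V) (P : ProbabilityMeasure (V → ℝ)) : Prop :=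
  ∀ (j k : V) (S : Finset V), j ≠ k → j ∉ S → k ∉ S →
    ((j, k, S) ∈ G.Dsep ↔ CondIndepCoord P j k S)

/-- Markov equivalence: the same distributions satisfy the CMC with respect to both graphs. -/
def MarkovEquiv (G₁ G₂ : DCG V) : Prop :=
  ∀ P : ProbabilityMeasure (V → ℝ), G₁.CMC P ↔ G₂.CMC P

/-- The Markov equivalence class of `G`. -/
def mec (G : DCG V) : Set (DCG V) := {G' | MarkovEquiv G G'}

/-- The identifiable SMR assumption for `(G, P)`. -/
def IdentifiableSMR (G : DCG V) (P : ProbabilityMeasure (V → ℝ)) : Prop :=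
  G.CMC P ∧ ∀ G' : DCG V, G'.CMC P → G' ∉ G.mec → G.skeletonCard < G'.skeletonCard

/-- The weak SMR (frugality) assumption for `(G, P)`. -/
def WeakSMR (G : DCG V) (P : ProbabilityMeasure (V → ℝ)) : Prop :=
  G.CMC P ∧ ∀ G' : DCG V, G'.CMC P → G' ∉ G.mec → G.skeletonCard ≤ G'.skeletonCard

/-- `G'` is strictly preferred to `G`: they are not Markov equivalent and `G'` entails strictly
more d-separation rules. -/
def StrictlyPreferred (G' G : DCG V) : Prop := G' ∉ G.mec ∧ G.Dsep ⊂ G'.Dsep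

/-- The P-minimality assumption for `(G, P)`: it satisfies the CMC and no graph satisfying the CMC
is strictly preferred to `G`. -/
def PMinimal (G : DCG V) (P : ProbabilityMeasure (V → ℝ)) : Prop :=
  G.CMC P ∧ ∀ G' : DCG V, G'.CMC P → ¬ StrictlyPreferred G' G

/-- `(G, P)` is a Gaussian linear DCG model: `P` is the law of the solution `X` of
`X = Bᵀ X + ε` with `ε ∼ N(0, I)` and `I - Bᵀ` invertible, where the entry `B j k` is
nonzero exactly when `j → k` is an edge of `G`. -/
def IsGaussianLinear [DecidableEq V] (G : DCG V) (P : ProbabilityMeasure (V → ℝ)) : Prop :=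
  ∃ B : Matrix V V ℝ, (∀ j k, B j k ≠ 0 ↔ G.Adj j k) ∧ IsUnit (1 - B.transpose).det ∧
    (P : Measure (V → ℝ)) =
      (Measure.pi fun _ : V => gaussianReal 0 1).map fun ε => (1 - B.transpose)⁻¹.mulVec ε

end DCG

end

/-!
The implications rest on one fact about skeletons: two vertices are adjacent in `S(G)`, really or
virtually, if and only if no set d-separates them. Adjacent vertices are always d-connected
(`DCG.dConnected_of_skeleton_adj`): by their edge, by `j → l ← k` if `l ∈ an(S)`, and otherwise by a
directed path from `l` that cannot meet `S`. Nonadjacent vertices are d-separated by their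
set of ancestors (`DCG.exists_mem_Dsep_of_not_skeleton_adj`), since an active path would have only
colliders as interior vertices. Hence a graph with fewer d-separation rules has a larger skeleton
(`DCG.skeleton_le_of_Dsep_subset`). If `G` is faithful to `P`, every graph that is Markov to `P` has
fewer rules than `G`, which gives the weak SMR assumption; and a strictly preferred graph has at
most as many edges, so it contradicts the identifiable SMR assumption.

Both examples come from one pair of cyclic graphs with the same skeleton and strictly nested
d-separation rules. Both have the loop `0 ⇄ 1` and a common cause `4` of all other vertices. In
`DCG.twoCauses` the vertices `2` and `3` enter the loop at different places, and they are separated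
by `{4}` and by `{0, 1, 4}`; in `DCG.causeEffect` the vertex `2` is a cause and `3` an effect of the
loop, and only `{0, 1, 4}` separates them. A model faithful to `twoCauses` is therefore Markov to
`causeEffect`, which is not Markov equivalent to `twoCauses` and has no more edges: the
identifiable SMR assumption fails. Conversely, a Gaussian model on `causeEffect` in which the
effects of `2` on `3` through the loop cancel can be faithful to `twoCauses`: it satisfies the weak
SMR assumption, but `twoCauses` is strictly preferred.

Conditional independence in a Gaussian vector is reduced to arithmetic: `X j ⊥ X k | X_S` if and
only if the residual of `X j` after regression on `X_S` is uncorrelated with `X k`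
(`condIndepCoord_iff_covariance_eq_zero`). For integer coefficient matrices with integer inverses
this covariance is computed by fraction-free elimination (`partialCov`), and the kernel evaluates it
for all triples.
-/

noncomputable section

namespace DCG

variable {V : Type*} {G : DCG V} {S : Finset V}

/-! ### Ancestors and d-connecting trails -/

lemma mem_an_of_mem {v : V} (h : v ∈ S) : v ∈ G.an S := ⟨v, h, Or.inl rfl⟩

lemma mem_an_of_adj {v w : V} (h : G.Adj v w) (hw : w ∈ G.an S) : v ∈ G.an S := by
  obtain ⟨s, hs, rfl | hws⟩ := hw
  · exact ⟨w, hs, Or.inr (.single h)⟩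
  · exact ⟨s, hs, Or.inr (.head h hws)⟩

lemma mem_an_of_isAncestor {v w : V} (h : G.IsAncestor v w) (hw : w ∈ G.an S) : v ∈ G.an S := by
  induction h using Relation.TransGen.head_induction_on with
  | single h => exact mem_an_of_adj h hw
  | head h _ ih => exact mem_an_of_adj h ih

/-- `an(S)` is the least set that contains `S` and is closed under taking parents. -/
lemma an_subset {A : Set V} (hS : ∀ s ∈ S, s ∈ A)
    (hA : ∀ v w, G.Adj v w → w ∈ A → v ∈ A) : G.an S ⊆ A := by
  rintro v ⟨s, hs, rfl | h⟩
  · exact hS _ hs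
  · induction h using Relation.TransGen.head_induction_on with
    | single h => exact hA _ _ h (hS _ hs)
    | head h _ ih => exact hA _ _ h ih

namespace Trail

lemma vertices_eq_cons {a b : V} (π : Trail G a b) : π.vertices = a :: π.vertices.tail := by
  cases π <;> rfl

lemma end_mem {a b : V} (π : Trail G a b) : b ∈ π.vertices := by
  induction π <;> simp_all [vertices]

/-- The reversal of the first trail, followed by the second one. -/
def revAppend : {a b c : V} → Trail G a b → Trail G a c → Trail G b c
  | _, _, _, .nil _, q => q
  | _, _, _, .fwd h p, q => revAppend p (.bwd h q)
  | _, _, _, .bwd h p, q => revAppend p (.fwd h q)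

/-- The condition that activity given `S` imposes on the vertex `a` at which the reversal of the
first trail is joined to the second one. -/
def Joint (S : Finset V) : {a b c : V} → Trail G a b → Trail G a c → Prop
  | _, _, _, .nil _, _ => True
  | _, _, _, .fwd _ _, .nil _ => True
  | _, _, _, .bwd _ _, .nil _ => True
  | a, _, _, .bwd _ _, .bwd _ _ => a ∈ G.an S
  | a, _, _, .bwd _ _, .fwd _ _ => a ∉ S
  | a, _, _, .fwd _ _, .bwd _ _ => a ∉ S
  | a, _, _, .fwd _ _, .fwd _ _ => a ∉ S

lemma Active.revAppend : ∀ {a b c : V} {p : Trail G a b} {q : Trail G a c},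
    p.Active S → q.Active S → Joint S p q → (p.revAppend q).Active S
  | _, _, _, .nil _, _, _, hq, _ => hq
  | _, _, _, .fwd h p, q, hp, hq, hpq => by
    refine Active.revAppend (p := p) (q := .bwd h q) ?_ ?_ ?_
    · cases p <;> simp_all [Active]
    · cases q <;> simp_all [Active, Joint]
    · cases p <;> simp_all [Active, Joint]
  | _, _, _, .bwd h p, q, hp, hq, hpq => by
    refine Active.revAppend (p := p) (q := .fwd h q) ?_ ?_ ?_
    · cases p <;> simp_all [Active]
    · cases q <;> simp_all [Active, Joint]
    · cases p <;> simp_all [Active, Joint]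

lemma vertices_revAppend : ∀ {a b c : V} (p : Trail G a b) (q : Trail G a c),
    (p.revAppend q).vertices = p.vertices.tail.reverse ++ q.vertices
  | _, _, _, .nil _, _ => rfl
  | a, _, _, .fwd h p, q => by
    rw [revAppend, vertices_revAppend p (.bwd h q)]
    simp only [vertices, List.tail_cons]
    rw [p.vertices_eq_cons]
    simp
  | a, _, _, .bwd h p, q => by
    rw [revAppend, vertices_revAppend p (.fwd h q)]
    simp only [vertices, List.tail_cons]
    rw [p.vertices_eq_cons]
    simp

/-- All edges of the trail are traversed forwards. -/
def IsForward : {a b : V} → Trail G a b → Prop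
  | _, _, .nil _ => True
  | _, _, .fwd _ p => p.IsForward
  | _, _, .bwd _ _ => False

lemma IsForward.reflTransGen : ∀ {a b : V} {π : Trail G a b}, π.IsForward →
    ∀ v ∈ π.vertices, Relation.ReflTransGen G.Adj a v
  | _, _, .nil _, _, v, hv => by
    rw [vertices, List.mem_singleton] at hv
    exact hv ▸ .refl
  | _, _, .fwd h p, hπ, v, hv => by
    rcases List.mem_cons.1 hv with rfl | hv
    · exact .refl
    · exact .head h (IsForward.reflTransGen (π := p) hπ v hv)

lemma IsForward.exists_suffix : ∀ {a b : V} {π : Trail G a b}, π.IsForward → π.vertices.Nodup →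
    ∀ v ∈ π.vertices, ∃ π' : Trail G v b, π'.IsForward ∧ π'.vertices.Nodup
  | a, _, .nil _, _, _, v, hv => by
    rw [vertices, List.mem_singleton] at hv
    subst hv
    exact ⟨.nil _, trivial, by simp [vertices]⟩
  | _, _, .fwd h p, hπ, hn, v, hv => by
    rcases List.mem_cons.1 hv with rfl | hv
    · exact ⟨.fwd h p, hπ, hn⟩
    · exact IsForward.exists_suffix (π := p) hπ (List.nodup_cons.1 hn).2 v hv

lemma exists_isForward {a b : V} (h : Relation.ReflTransGen G.Adj a b) :
    ∃ π : Trail G a b, π.IsForward ∧ π.vertices.Nodup := by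
  induction h using Relation.ReflTransGen.head_induction_on with
  | refl => exact ⟨.nil _, trivial, by simp [vertices]⟩
  | @head a c h _ ih =>
    obtain ⟨π, hπ, hn⟩ := ih
    by_cases ha : a ∈ π.vertices
    · exact hπ.exists_suffix hn a ha
    · exact ⟨.fwd h π, hπ, List.nodup_cons.2 ⟨ha, hn⟩⟩

/-- A directed path that starts outside of `an(S)` never meets `S`. -/
lemma IsForward.active : ∀ {a b : V} {π : Trail G a b}, π.IsForward → a ∉ G.an S → π.Active S
  | _, _, .nil _, _, _ => by simp [Active]
  | _, _, .fwd _ (.nil _), _, _ => by simp [Active]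
  | _, _, .fwd h (.fwd h' p), hπ, ha => by
    have hb := fun hb => ha (mem_an_of_adj h hb)
    exact ⟨fun h => hb (mem_an_of_mem h), IsForward.active (π := .fwd h' p) hπ hb⟩
  | _, _, .fwd _ (.bwd _ _), hπ, _ => hπ.elim

/-- Following an active trail forwards, one ends at a collider or at the end of the trail. -/
lemma Active.mem_an_or_isAncestor : ∀ {a b c : V} {h : G.Adj a b} {p : Trail G b c},
    (Trail.fwd h p).Active S → a ∈ G.an S ∨ G.IsAncestor a c
  | _, _, _, h, .nil _, _ => Or.inr (.single h)
  | _, _, _, h, .fwd h' p, hp =>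
    (Active.mem_an_or_isAncestor (h := h') (p := p) hp.2).imp (mem_an_of_adj h) (.head h)
  | _, _, _, h, .bwd _ _, hp => Or.inl (mem_an_of_adj h hp.1)

/-- Invariants bound what active trails can reach: if `I` contains the vertices that are entered
through an arrowhead and `O` those that are entered through a tail, then the trail ends in `I` or
in `O`. The set `A` is an upper bound for `an(S)`. -/
lemma Active.end_mem_of_invariant {A I O : Finset V} (hA : ∀ v ∈ G.an S, v ∈ A)
    (hI_fwd : ∀ v w, v ∈ I → v ∉ S → G.Adj v w → w ∈ I)
    (hI_bwd : ∀ v w, v ∈ I → v ∈ A → G.Adj w v → w ∈ O)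
    (hO_fwd : ∀ v w, v ∈ O → v ∉ S → G.Adj v w → w ∈ I)
    (hO_bwd : ∀ v w, v ∈ O → v ∉ S → G.Adj w v → w ∈ O) {b c : V} (p : Trail G b c) :
    (∀ a (h : G.Adj a b), (Trail.fwd h p).Active S → b ∈ I → c ∈ I ∨ c ∈ O) ∧
      (∀ a (h : G.Adj b a), (Trail.bwd h p).Active S → b ∈ O → c ∈ I ∨ c ∈ O) := by
  induction p with
  | nil b => exact ⟨fun _ _ _ hb => Or.inl hb, fun _ _ _ hb => Or.inr hb⟩
  | fwd h' p ih =>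
    exact ⟨fun _ _ hp hb => ih.1 _ h' hp.2 (hI_fwd _ _ hb hp.1 h'),
      fun _ _ hp hb => ih.1 _ h' hp.2 (hO_fwd _ _ hb hp.1 h')⟩
  | bwd h' p ih =>
    exact ⟨fun _ _ hp hb => ih.2 _ h' hp.2 (hI_bwd _ _ hb (hA _ hp.1) h'),
      fun _ _ hp hb => ih.2 _ h' hp.2 (hO_bwd _ _ hb hp.1 h')⟩

end Trail

/-- A certificate of d-separation: the set `A` contains `S` and is closed under taking parents, `I`
and `O` are as in `Trail.Active.end_mem_of_invariant`, and neither contains `k`. -/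
lemma not_dConnected_of_invariant {j k : V} (A I O : Finset V) (hjk : j ≠ k)
    (hSA : ∀ s ∈ S, s ∈ A) (hA : ∀ v w, G.Adj v w → w ∈ A → v ∈ A)
    (hjI : ∀ w, G.Adj j w → w ∈ I) (hjO : ∀ w, G.Adj w j → w ∈ O)
    (hI_fwd : ∀ v w, v ∈ I → v ∉ S → G.Adj v w → w ∈ I)
    (hI_bwd : ∀ v w, v ∈ I → v ∈ A → G.Adj w v → w ∈ O)
    (hO_fwd : ∀ v w, v ∈ O → v ∉ S → G.Adj v w → w ∈ I)
    (hO_bwd : ∀ v w, v ∈ O → v ∉ S → G.Adj w v → w ∈ O) (hkI : k ∉ I) (hkO : k ∉ O) :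
    ¬ G.DConnected j k S := by
  rintro ⟨π, -, hπ⟩
  have hA' : ∀ v ∈ G.an S, v ∈ A := an_subset (A := {v | v ∈ A}) hSA hA
  cases π with
  | nil => exact hjk rfl
  | fwd h p =>
    exact ((Trail.Active.end_mem_of_invariant hA' hI_fwd hI_bwd hO_fwd hO_bwd p).1 _ h hπ
      (hjI _ h)).elim hkI hkO
  | bwd h p =>
    exact ((Trail.Active.end_mem_of_invariant hA' hI_fwd hI_bwd hO_fwd hO_bwd p).2 _ h hπ
      (hjO _ h)).elim hkI hkO

lemma DConnected.symm {j k : V} (h : G.DConnected j k S) : G.DConnected k j S := by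
  obtain ⟨π, hn, hπ⟩ := h
  refine ⟨π.revAppend (.nil j), ?_, hπ.revAppend (by simp [Trail.Active]) (by cases π <;> trivial)⟩
  rw [π.vertices_eq_cons, List.nodup_cons] at hn
  rw [Trail.vertices_revAppend, Trail.vertices]
  simpa [List.nodup_append] using ⟨hn.2, fun a ha h => hn.1 (h ▸ ha)⟩

lemma mem_Dsep_comm {j k : V} : (j, k, S) ∈ G.Dsep ↔ (k, j, S) ∈ G.Dsep :=
  ⟨fun h => ⟨h.1.symm, h.2.2.1, h.2.1, fun h' => h.2.2.2 h'.symm⟩,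
    fun h => ⟨h.1.symm, h.2.2.1, h.2.1, fun h' => h.2.2.2 h'.symm⟩⟩

/-! ### Skeletons and d-separation -/

/-- If `j → l`, and `l` is an ancestor of `k` outside of `an(S)`, then a directed path from `l`
to `k` (or from `j` to `k`) avoids `S`. -/
lemma dConnected_of_adj_of_isAncestor {j k l : V} (hjl : G.Adj j l) (hlk : G.IsAncestor l k)
    (hl : l ∉ G.an S) : G.DConnected j k S := by
  by_cases hj : Relation.ReflTransGen G.Adj l j
  · have hj' : j ∉ G.an S := by
      rcases Relation.reflTransGen_iff_eq_or_transGen.1 hj with rfl | h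
      · exact hl
      · exact fun hj => hl (mem_an_of_isAncestor h hj)
    obtain ⟨π, hπ, hn⟩ := Trail.exists_isForward (G := G) (.head hjl hlk.to_reflTransGen)
    exact ⟨π, hn, hπ.active hj'⟩
  · obtain ⟨π, hπ, hn⟩ := Trail.exists_isForward (G := G) hlk.to_reflTransGen
    refine ⟨.fwd hjl π, List.nodup_cons.2 ⟨fun h => hj (hπ.reflTransGen _ h), hn⟩, ?_⟩
    have ha := hπ.active hl
    cases π with
    | nil => simp [Trail.Active]
    | fwd h p => exact ⟨fun h => hl (mem_an_of_mem h), ha⟩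
    | bwd h p => exact hπ.elim

/-- Vertices that are really or virtually adjacent are d-connected given every set. -/
lemma dConnected_of_skeleton_adj {j k : V} (h : G.skeleton.Adj j k) (S : Finset V) :
    G.DConnected j k S := by
  obtain ⟨hne, (h | h) | ⟨l, hj, hk, hl⟩⟩ := h
  · exact ⟨.fwd h (.nil _), by simpa [Trail.vertices] using hne, by simp [Trail.Active]⟩
  · exact ⟨.bwd h (.nil _), by simpa [Trail.vertices] using hne, by simp [Trail.Active]⟩
  · by_cases hS : l ∈ G.an S
    · refine ⟨.fwd hj (.bwd hk (.nil _)), ?_, by simpa [Trail.Active] using hS⟩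
      have h1 : j ≠ l := fun h => G.irrefl l (h ▸ hj)
      have h2 : l ≠ k := fun h => G.irrefl k (h ▸ hk)
      simp [Trail.vertices, h1, h2, hne]
    · rcases hl with hl | hl
      · exact (dConnected_of_adj_of_isAncestor hk hl hS).symm
      · exact dConnected_of_adj_of_isAncestor hj hl hS

/-- If `S` contains all ancestors of `j` and `k` other than `j` and `k` themselves, then only
colliders can be interior vertices of an active path from `j` to `k`. Two consecutive vertices are
never both colliders, so the path is an edge or `j → l ← k`. -/
lemma Trail.Active.skeleton_adj [DecidableEq V] : ∀ {j k : V} {π : Trail G j k}, π.Active S →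
    π.vertices.Nodup → j ≠ k → (∀ v, v ∈ G.an {j, k} → v ≠ j → v ≠ k → v ∈ S) →
    G.an S ⊆ G.an {j, k} → G.skeleton.Adj j k
  | _, _, .nil _, _, _, hne, _, _ => (hne rfl).elim
  | _, _, .fwd h (.nil _), _, _, hne, _, _ => ⟨hne, Or.inl (Or.inl h)⟩
  | _, _, .bwd h (.nil _), _, _, hne, _, _ => ⟨hne, Or.inl (Or.inr h)⟩
  | j, k, .fwd (b := b) h (.fwd h' p), hπ, hn, hne, hS, hanS => by
    have hb : b ∈ G.an {j, k} := by
      rcases hπ.2.mem_an_or_isAncestor with hb | hb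
      · exact hanS hb
      · exact ⟨k, by simp, Or.inr hb⟩
    have := p.end_mem
    simp only [vertices, List.nodup_cons, List.mem_cons] at hn
    exact (hπ.1 (hS b hb (by grind) (by grind))).elim
  | j, k, .bwd (b := b) h (.fwd h' p), hπ, hn, hne, hS, hanS => by
    have hb : b ∈ G.an {j, k} := ⟨j, by simp, Or.inr (.single h)⟩
    have := p.end_mem
    simp only [vertices, List.nodup_cons, List.mem_cons] at hn
    exact (hπ.1 (hS b hb (by grind) (by grind))).elim
  | j, k, .bwd (b := b) h (.bwd h' p), hπ, hn, hne, hS, hanS => by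
    have hb : b ∈ G.an {j, k} := ⟨j, by simp, Or.inr (.single h)⟩
    have := p.end_mem
    simp only [vertices, List.nodup_cons, List.mem_cons] at hn
    exact (hπ.1 (hS b hb (by grind) (by grind))).elim
  | j, k, .fwd (b := b) h (.bwd h' (.nil _)), hπ, hn, hne, hS, hanS => by
    obtain ⟨s, hs, hb⟩ := hanS hπ.1
    simp only [vertices, List.nodup_cons, List.mem_cons] at hn
    refine ⟨hne, Or.inr ⟨b, h, h', ?_⟩⟩
    simp only [Finset.mem_insert, Finset.mem_singleton] at hs
    grind
  | j, k, .fwd (b := b) h (.bwd (b := c) h' (.fwd h'' p)), hπ, hn, hne, hS, hanS => by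
    have hc : c ∈ G.an {j, k} := hanS (mem_an_of_adj h' hπ.1)
    have := p.end_mem
    simp only [vertices, List.nodup_cons, List.mem_cons] at hn
    exact (hπ.2.1 (hS c hc (by grind) (by grind))).elim
  | j, k, .fwd (b := b) h (.bwd (b := c) h' (.bwd h'' p)), hπ, hn, hne, hS, hanS => by
    have hc : c ∈ G.an {j, k} := hanS (mem_an_of_adj h' hπ.1)
    have := p.end_mem
    simp only [vertices, List.nodup_cons, List.mem_cons] at hn
    exact (hπ.2.1 (hS c hc (by grind) (by grind))).elim

/-- Vertices that are neither really nor virtually adjacent are d-separated by the ancestors of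
the two vertices. -/
lemma exists_mem_Dsep_of_not_skeleton_adj [Finite V] {j k : V} (hne : j ≠ k)
    (h : ¬ G.skeleton.Adj j k) : ∃ S : Finset V, (j, k, S) ∈ G.Dsep := by
  classical
  have := Fintype.ofFinite V
  -- The separating set consists of the proper ancestors of the two vertices.
  let S : Finset V := {v | v ∈ G.an {j, k} ∧ v ≠ j ∧ v ≠ k}
  have hanS : G.an S ⊆ G.an {j, k} :=
    an_subset (fun s hs => (Finset.mem_filter.1 hs).2.1) fun v w => mem_an_of_adj
  refine ⟨S, hne, by simp [S], by simp [S], ?_⟩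
  rintro ⟨π, hn, hπ⟩
  exact h (hπ.skeleton_adj hn hne (fun v h₁ h₂ h₃ => by simp [S, h₁, h₂, h₃]) hanS)

/-- A graph that entails fewer d-separation rules has more (real or virtual) edges. -/
lemma skeleton_le_of_Dsep_subset [Finite V] {G₁ G₂ : DCG V} (h : G₁.Dsep ⊆ G₂.Dsep) :
    G₂.skeleton ≤ G₁.skeleton := by
  intro j k hjk
  by_contra h'
  obtain ⟨S, hS⟩ := exists_mem_Dsep_of_not_skeleton_adj hjk.ne h'
  exact (h hS).2.2.2 (dConnected_of_skeleton_adj hjk S)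

lemma skeletonCard_le_of_skeleton_le [Finite V] {G₁ G₂ : DCG V} (h : G₁.skeleton ≤ G₂.skeleton) :
    G₁.skeletonCard ≤ G₂.skeletonCard :=
  Set.ncard_le_ncard (SimpleGraph.edgeSet_mono h) (Set.toFinite _)

variable [Fintype V] {P : ProbabilityMeasure (V → ℝ)}

lemma CFC.cmc (h : G.CFC P) : G.CMC P := fun j k S hS => (h j k S hS.1 hS.2.1 hS.2.2.1).1 hS

lemma CFC.Dsep_subset (h : G.CFC P) {G' : DCG V} (h' : G'.CMC P) : G'.Dsep ⊆ G.Dsep := by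
  rintro ⟨j, k, S⟩ hS
  exact (h j k S hS.1 hS.2.1 hS.2.2.1).2 (h' j k S hS)

/-- A graph that is faithful to `P` has the fewest edges among all graphs that are Markov
to `P`. -/
lemma CFC.skeletonCard_le (h : G.CFC P) {G' : DCG V} (h' : G'.CMC P) :
    G.skeletonCard ≤ G'.skeletonCard :=
  skeletonCard_le_of_skeleton_le (skeleton_le_of_Dsep_subset (h.Dsep_subset h'))

theorem CFC.weakSMR (h : G.CFC P) : G.WeakSMR P := ⟨h.cmc, fun _ h' _ => h.skeletonCard_le h'⟩

theorem IdentifiableSMR.pMinimal (h : G.IdentifiableSMR P) : G.PMinimal P :=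
  ⟨h.1, fun G' h' hG' => (h.2 G' h' hG'.1).not_ge
    (skeletonCard_le_of_skeleton_le (skeleton_le_of_Dsep_subset hG'.2.subset))⟩

end DCG

/-! ### Conditional independence given a residual decomposition -/

section Probability

variable {Ω γ β δ : Type*} [MeasurableSpace Ω] [MeasurableSpace γ] [MeasurableSpace β]
  [MeasurableSpace δ] {μ : Measure Ω} [IsProbabilityMeasure μ]

/-- If `U` is independent of `W`, then the conditional law of `F(W, U)` given `W = w` is the law of
`F(w, U)`. -/
lemma condDistrib_comp_of_indepFun [StandardBorelSpace δ] [Nonempty δ] {W : Ω → γ} {U : Ω → β}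
    (hW : Measurable W) (hU : Measurable U) (h : IndepFun W U μ) {F : γ × β → δ}
    (hF : Measurable F) :
    condDistrib (fun ω => F (W ω, U ω)) W μ =ᵐ[μ.map W]
      (Kernel.id ×ₖ Kernel.const γ (μ.map U)).map F := by
  have := Measure.isProbabilityMeasure_map (μ := μ) hU.aemeasurable
  have := Measure.isProbabilityMeasure_map (μ := μ) hW.aemeasurable
  have hκ : ∀ w {t : Set δ}, MeasurableSet t →
      (Kernel.id ×ₖ Kernel.const γ (μ.map U)).map F w t = μ.map U {u | F (w, u) ∈ t} := by
    intro w t ht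
    rw [Kernel.map_apply' _ hF _ ht, Kernel.prod_apply, Kernel.id_apply, Kernel.const_apply,
      Measure.dirac_prod, Measure.map_apply (by fun_prop) (hF ht)]
    rfl
  have : IsMarkovKernel ((Kernel.id ×ₖ Kernel.const γ (μ.map U)).map F) :=
    Kernel.IsMarkovKernel.map _ hF
  refine condDistrib_ae_eq_of_measure_eq_compProd W (by fun_prop) ?_
  refine Measure.ext_prod fun {s t} hs ht => ?_
  have hst : MeasurableSet {p : γ × β | p.1 ∈ s ∧ F p ∈ t} := (measurable_fst hs).inter (hF ht)
  rw [Measure.compProd_apply_prod hs ht, Measure.map_apply (by fun_prop) (hs.prod ht)]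
  calc μ ((fun ω => (W ω, F (W ω, U ω))) ⁻¹' s ×ˢ t)
      = μ.map (fun ω => (W ω, U ω)) {p | p.1 ∈ s ∧ F p ∈ t} := by
        rw [Measure.map_apply (by fun_prop) hst]; rfl
    _ = ∫⁻ w, μ.map U {u | w ∈ s ∧ F (w, u) ∈ t} ∂μ.map W := by
        rw [(indepFun_iff_map_prod_eq_prod_map_map hW.aemeasurable hU.aemeasurable).1 h,
          Measure.prod_apply hst]
        rfl
    _ = _ := by
        rw [← lintegral_indicator hs]
        refine lintegral_congr fun w => ?_
        by_cases hw : w ∈ s <;> simp [hw, hκ w ht]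

/-- Conditional independence given `Z` of a function of `(Z, U)` and of `Y`, when `U` is
independent of `(Z, Y)`. -/
lemma condIndepFun_of_indepFun_prod [StandardBorelSpace Ω] [StandardBorelSpace δ] [Nonempty δ]
    {ε : Type*} [MeasurableSpace ε] [StandardBorelSpace ε] [Nonempty ε]
    {Z : Ω → γ} {Y : Ω → ε} {U : Ω → β} (hZ : Measurable Z) (hY : Measurable Y) (hU : Measurable U)
    (h : IndepFun (fun ω => (Z ω, Y ω)) U μ) {F : γ × β → δ} (hF : Measurable F) :
    (fun ω => F (Z ω, U ω)) ⟂ᵢ[Z, hZ; μ] Y := by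
  refine CondIndepFun.symm ?_
  rw [condIndepFun_iff_condDistrib_prod_ae_eq_prodMkRight (by fun_prop) hY hZ]
  have h₁ := condDistrib_comp_of_indepFun (hZ.prodMk hY) hU h
    (F := fun p => F (p.1.1, p.2)) (by fun_prop)
  have h₂ := condDistrib_comp_of_indepFun hZ hU (h.comp measurable_fst measurable_id) hF
  have h₃ : μ.map Z = (μ.map fun ω => (Z ω, Y ω)).map Prod.fst := by
    rw [Measure.map_map measurable_fst (by fun_prop)]; rfl
  rw [h₃] at h₂
  filter_upwards [h₁, ae_of_ae_map measurable_fst.aemeasurable h₂] with p hp₁ hp₂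
  rw [hp₁, Kernel.prodMkRight_apply, hp₂]
  have := Measure.isProbabilityMeasure_map (μ := μ) hU.aemeasurable
  ext t ht
  rw [Kernel.map_apply' _ hF _ ht, Kernel.map_apply' _ (by fun_prop) _ ht, Kernel.prod_apply,
    Kernel.prod_apply, Kernel.id_apply, Kernel.id_apply, Kernel.const_apply, Kernel.const_apply,
    Measure.dirac_prod, Measure.dirac_prod, Measure.map_apply (by fun_prop) (hF ht),
    Measure.map_apply (by fun_prop)
      ((by fun_prop : Measurable fun q : (γ × ε) × β => F (q.1.1, q.2)) ht)]
  rfl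

/-- If `f` and `g` are conditionally independent given `Z`, then the residual `f - L(Z)`, when
independent of `Z`, is uncorrelated with `g`. -/
lemma covariance_residual_eq_zero [StandardBorelSpace Ω]
    {Z : Ω → γ} {f g : Ω → ℝ} (hZ : Measurable Z) (hf : Measurable f) (hg : Measurable g)
    (h : f ⟂ᵢ[Z, hZ; μ] g) {L : γ → ℝ} (hL : Measurable L)
    (hU : IndepFun (fun ω => f ω - L (Z ω)) Z μ) (hf2 : MemLp f 2 μ) (hg2 : MemLp g 2 μ)
    (hU2 : MemLp (fun ω => f ω - L (Z ω)) 2 μ) :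
    cov[fun ω => f ω - L (Z ω), g; μ] = 0 := by
  -- `E[f | Z, g] = E[f | Z]`, so `E[U | Z, g] = E[U | Z]`, which is constant by independence.
  set U : Ω → ℝ := fun ω => f ω - L (Z ω) with hUdef
  have hUm : Measurable U := by fun_prop
  have hZg : Measurable (fun ω => (Z ω, g ω)) := hZ.prodMk hg
  have hfi : Integrable f μ := hf2.integrable (by norm_num)
  have hUi : Integrable U μ := hU2.integrable (by norm_num)
  have hLi : Integrable (fun ω => L (Z ω)) μ :=
    (hfi.sub hUi).congr (.of_forall fun ω => by simp [hUdef])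
  have hUg : Integrable (U * g) μ := hU2.integrable_mul hg2
  have hUeq : U = f - fun ω => L (Z ω) := rfl
  have h₁ := condExp_ae_eq_integral_condDistrib' (μ := μ) hZg hfi
  have h₂ := condExp_ae_eq_integral_condDistrib' (μ := μ) hZ hfi
  have h₃ := ae_of_ae_map hZg.aemeasurable
    ((condIndepFun_iff_condDistrib_prod_ae_eq_prodMkRight hf hg hZ).1 h.symm)
  have hL₁ : μ[fun ω => L (Z ω)|MeasurableSpace.comap (fun ω => (Z ω, g ω)) inferInstance]
      = fun ω => L (Z ω) :=
    condExp_of_stronglyMeasurable hZg.comap_le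
      (((hL.comp measurable_fst).comp (comap_measurable _)).stronglyMeasurable) hLi
  have hL₂ : μ[fun ω => L (Z ω)|MeasurableSpace.comap Z inferInstance] = fun ω => L (Z ω) :=
    condExp_of_stronglyMeasurable hZ.comap_le
      ((hL.comp (comap_measurable _)).stronglyMeasurable) hLi
  have hconst : μ[U|MeasurableSpace.comap Z inferInstance] =ᵐ[μ] fun _ => ∫ ω, U ω ∂μ :=
    condExp_indep_eq hUm.comap_le hZ.comap_le (comap_measurable _).stronglyMeasurable hU
  have hres : μ[U|MeasurableSpace.comap (fun ω => (Z ω, g ω)) inferInstance]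
      =ᵐ[μ] fun _ => ∫ ω, U ω ∂μ := by
    have e₁ := condExp_sub hfi hLi (MeasurableSpace.comap (fun ω => (Z ω, g ω)) inferInstance)
    have e₂ := condExp_sub hfi hLi (MeasurableSpace.comap Z inferInstance)
    rw [← hUeq, hL₁] at e₁
    rw [← hUeq, hL₂] at e₂
    filter_upwards [e₁, e₂, h₁, h₂, h₃, hconst] with ω e₁ e₂ h₁ h₂ h₃ hc
    rw [← hc, e₁, e₂, Pi.sub_apply, Pi.sub_apply, h₁, h₂, h₃, Kernel.prodMkRight_apply]
  have hpull : μ[U * g|MeasurableSpace.comap (fun ω => (Z ω, g ω)) inferInstance]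
      =ᵐ[μ] μ[U|MeasurableSpace.comap (fun ω => (Z ω, g ω)) inferInstance] * g :=
    condExp_mul_of_stronglyMeasurable_right
      ((measurable_snd.comp (comap_measurable _)).stronglyMeasurable) hUg hUi
  rw [covariance_eq_sub hU2 hg2, ← integral_condExp hZg.comap_le (f := U * g), sub_eq_zero]
  calc _ = ∫ ω, (∫ ω', U ω' ∂μ) * g ω ∂μ := by
        refine integral_congr_ae ?_
        filter_upwards [hpull, hres] with ω h₁ h₂
        rw [h₁, Pi.mul_apply, h₂]
    _ = _ := integral_const_mul _ _

end Probability

/-! ### Conditional independence of the coordinates of a Gaussian vector -/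

section Gaussian

variable {V : Type*} [Fintype V] {P : Measure (V → ℝ)} [IsGaussian P]

lemma memLp_two_eval (v : V) : MemLp (fun x : V → ℝ => x v) 2 P :=
  (IsGaussian.hasGaussianLaw_id (μ := P)).memLp_two.eval v

lemma memLp_two_dotProduct (u : V → ℝ) : MemLp (fun x : V → ℝ => u ⬝ᵥ x) 2 P :=
  memLp_finsetSum _ fun v _ => (memLp_two_eval v).const_mul (u v)

lemma covariance_dotProduct_left (u : V → ℝ) {Y : (V → ℝ) → ℝ} (hY : MemLp Y 2 P) :
    cov[fun x : V → ℝ => u ⬝ᵥ x, Y; P] = ∑ v, u v * cov[fun x : V → ℝ => x v, Y; P] := by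
  simp only [dotProduct]
  rw [covariance_fun_sum_left (fun v => (memLp_two_eval v).const_mul (u v)) hY]
  simp [covariance_const_mul_left]

/-- A linear functional of a Gaussian vector that is uncorrelated with some of the coordinates is
jointly independent of them. -/
lemma indepFun_dotProduct_restrict (u : V → ℝ) (T : Finset V)
    (h : ∀ t ∈ T, cov[fun x : V → ℝ => u ⬝ᵥ x, fun x => x t; P] = 0) :
    IndepFun (fun x : V → ℝ => u ⬝ᵥ x) (fun x (t : T) => x t) P := by
  let Φ : (V → ℝ) →ₗ[ℝ] (Unit → ℝ) × (T → ℝ) :=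
    (LinearMap.pi fun _ => dotProductBilin ℝ ℝ u).prod
      (LinearMap.pi fun t => LinearMap.proj (t : V))
  have hΦ := (IsGaussian.hasGaussianLaw_id (μ := P)).map (LinearMap.toContinuousLinearMap Φ)
  have := HasGaussianLaw.indepFun_of_covariance_eval (X := fun (_ : Unit) (x : V → ℝ) => u ⬝ᵥ x)
    (Y := fun (t : T) (x : V → ℝ) => x t) hΦ fun _ t => h t t.2
  exact this.comp (measurable_pi_apply ()) measurable_id

/-- Let `U = ∑ v, u v * X v` be a residual of `X j` after regression on `X_S`, that is, `U` is
uncorrelated with `X_S` and `X j - U` is a linear combination of `X_S`. Then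
`X j ⊥ X k | X_S` if and only if `U` is uncorrelated with `X k`. -/
lemma condIndepCoord_iff_covariance_eq_zero (P : ProbabilityMeasure (V → ℝ))
    [IsGaussian (P : Measure (V → ℝ))] {j k : V} {S : Finset V} {u : V → ℝ} (hj : j ∉ S)
    (huj : u j = 1) (hu : ∀ v ∉ S, v ≠ j → u v = 0)
    (hS : ∀ s ∈ S, cov[fun x : V → ℝ => u ⬝ᵥ x, fun x => x s; P] = 0) :
    DCG.CondIndepCoord P j k S ↔ cov[fun x : V → ℝ => u ⬝ᵥ x, fun x => x k; P] = 0 := by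
  classical
  have hZ : Measurable fun (x : V → ℝ) (i : S) => x i :=
    measurable_pi_lambda _ fun i => measurable_pi_apply (i : V)
  let L : (S → ℝ) → ℝ := fun z => -∑ s : S, u s * z s
  have hL : Measurable L := by fun_prop
  have hU : ∀ x : V → ℝ, u ⬝ᵥ x = x j - L fun i : S => x i := by
    intro x
    have h₁ : ∑ v ∈ insert j S, u v * x v = u ⬝ᵥ x := by
      refine Finset.sum_subset (Finset.subset_univ _) fun v _ hv => ?_
      rw [Finset.mem_insert, not_or] at hv
      rw [hu v hv.2 hv.1, zero_mul]
    rw [← h₁, Finset.sum_insert hj, huj, one_mul, sub_neg_eq_add,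
      Finset.sum_coe_sort S fun v => u v * x v]
  constructor
  · intro h
    have hind := indepFun_dotProduct_restrict (P := P) u S hS
    simp only [hU] at hind ⊢
    refine covariance_residual_eq_zero hZ (measurable_pi_apply j) (measurable_pi_apply k) h hL hind
      (memLp_two_eval j) (memLp_two_eval k) ?_
    simpa only [hU] using memLp_two_dotProduct (P := (P : Measure (V → ℝ))) u
  · intro h
    have hind := indepFun_dotProduct_restrict (P := P) u (insert k S) fun t ht => by
      rcases Finset.mem_insert.1 ht with rfl | ht
      · exact h
      · exact hS t ht
    have hind' := (hind.symm.comp (φ := fun z : ↥(insert k S) → ℝ =>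
      ((fun i : S => z ⟨(i : V), Finset.mem_insert_of_mem i.2⟩), z ⟨k, Finset.mem_insert_self k S⟩))
      (by fun_prop) measurable_id)
    have := condIndepFun_of_indepFun_prod hZ (measurable_pi_apply k) (by fun_prop) hind'
      (F := fun p => p.2 + L p.1) (by fun_prop)
    have e : (fun x : V → ℝ => x j) = fun x => u ⬝ᵥ x + L fun i : S => x i := by
      funext x; rw [hU]; ring
    rw [DCG.CondIndepCoord, e]
    exact this

end Gaussian

/-! ### The law of a linear transformation of standard Gaussian noise -/

section LinearGaussian

variable {V : Type*} [Fintype V]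

instance isGaussian_pi_gaussianReal :
    IsGaussian (Measure.pi fun _ : V => gaussianReal 0 1) := by
  have h : iIndepFun (fun (v : V) (x : V → ℝ) => x v) (Measure.pi fun _ : V => gaussianReal 0 1) :=
    iIndepFun_pi (X := fun _ => id) fun _ => aemeasurable_id
  have hX : ∀ v : V, HasGaussianLaw (fun x : V → ℝ => x v)
      (Measure.pi fun _ : V => gaussianReal 0 1) := fun v =>
    ⟨by rw [(measurePreserving_eval (fun _ : V => gaussianReal 0 1) v).map_eq]; infer_instance⟩
  have := (h.hasGaussianLaw hX).isGaussian_map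
  rwa [show (fun (x : V → ℝ) (v : V) => x v) = id from rfl, Measure.map_id] at this

lemma covariance_eval_pi_gaussianReal [DecidableEq V] (v w : V) :
    cov[fun x : V → ℝ => x v, fun x => x w; Measure.pi fun _ : V => gaussianReal 0 1] =
      (1 : Matrix V V ℝ) v w := by
  rcases eq_or_ne v w with rfl | hvw
  · rw [covariance_self (measurable_pi_apply v).aemeasurable, Matrix.one_apply_eq]
    have := (measurePreserving_eval (fun _ : V => gaussianReal 0 1) v)
    have h := variance_map (μ := Measure.pi fun _ : V => gaussianReal 0 1)
      (X := (id : ℝ → ℝ)) (Y := Function.eval v) aemeasurable_id this.measurable.aemeasurable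
    rw [this.map_eq, variance_id_gaussianReal] at h
    simpa using h.symm
  · have h : iIndepFun (fun (v : V) (x : V → ℝ) => x v)
        (Measure.pi fun _ : V => gaussianReal 0 1) :=
      iIndepFun_pi (X := fun _ => id) fun _ => aemeasurable_id
    rw [Matrix.one_apply_ne hvw]
    exact (h.indepFun hvw).covariance_eq_zero (memLp_two_eval v) (memLp_two_eval w)

/-- The law of `A ε` for a standard Gaussian vector `ε`. -/
def gaussianLaw (A : Matrix V V ℝ) : ProbabilityMeasure (V → ℝ) :=
  ⟨(Measure.pi fun _ : V => gaussianReal 0 1).map A.mulVec,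
    Measure.isProbabilityMeasure_map (by fun_prop)⟩

instance isGaussian_gaussianLaw (A : Matrix V V ℝ) :
    IsGaussian (gaussianLaw A : Measure (V → ℝ)) :=
  isGaussian_map (μ := Measure.pi fun _ : V => gaussianReal 0 1)
    (LinearMap.toContinuousLinearMap A.mulVecLin)

lemma covariance_gaussianLaw (A : Matrix V V ℝ) (j k : V) :
    cov[fun x : V → ℝ => x j, fun x => x k; gaussianLaw A] = (A * A.transpose) j k := by
  classical
  change cov[_, _; (Measure.pi fun _ : V => gaussianReal 0 1).map A.mulVec] = _
  rw [covariance_map (measurable_pi_apply j).aestronglyMeasurable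
    (measurable_pi_apply k).aestronglyMeasurable (by fun_prop)]
  change cov[fun x => A j ⬝ᵥ x, fun x => A k ⬝ᵥ x; _] = _
  rw [covariance_dotProduct_left _ (memLp_two_dotProduct _), Matrix.mul_apply]
  refine Finset.sum_congr rfl fun v _ => ?_
  rw [covariance_comm, covariance_dotProduct_left _ (memLp_two_eval v)]
  simp [covariance_eval_pi_gaussianReal, Matrix.one_apply]

end LinearGaussian

/-! ### Partial covariances by elimination -/

section Elimination

variable {V R : Type*} [CommRing R]

/-- Fraction-free Gaussian elimination: up to a factor, entry `(j, k)` is the partial covariance of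
`j` and `k` given the vertices in the list, for the covariance matrix `K`. -/
def partialCov (K : V → V → R) : List V → V → V → R
  | [], j, k => K j k
  | s :: L, j, k =>
      partialCov K L s s * partialCov K L j k - partialCov K L j s * partialCov K L s k

/-- The product of the pivots used in `partialCov K L`. -/
def pivotProd (K : V → V → R) : List V → R
  | [] => 1
  | s :: L => partialCov K L s s * pivotProd K L

lemma partialCov_map {R' : Type*} [CommRing R'] (f : R →+* R') (K : V → V → R) (L : List V)
    (j k : V) : partialCov (fun v w => f (K v w)) L j k = f (partialCov K L j k) := by
  induction L generalizing j k with
  | nil => rfl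
  | cons s L ih => simp [partialCov, ih]

lemma pivotProd_map {R' : Type*} [CommRing R'] (f : R →+* R') (K : V → V → R) (L : List V) :
    pivotProd (fun v w => f (K v w)) L = f (pivotProd K L) := by
  induction L with
  | nil => simp [pivotProd]
  | cons s L ih => simp [pivotProd, partialCov_map, ih]

lemma partialCov_eq_zero_of_mem (K : V → V → R) {L : List V} {t : V} (ht : t ∈ L) (j : V) :
    partialCov K L j t = 0 := by
  induction L generalizing j with
  | nil => simp at ht
  | cons s L ih =>
    rcases List.mem_cons.1 ht with rfl | ht
    · simp only [partialCov]; ring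
    · simp [partialCov, ih ht]

/-- Row `j` of `partialCov K L` consists of the covariances with a multiple of the residual of `j`
after regression on `L`: elimination changes the vector `u = e_j` only at `j` and at the vertices
in `L`. -/
lemma exists_residual [Fintype V] (K : V → V → R) (L : List V) (j : V) :
    ∃ u : V → R, (∀ v ∉ L, v ≠ j → u v = 0) ∧ (j ∉ L → u j = pivotProd K L) ∧
      ∀ k, ∑ v, u v * K v k = partialCov K L j k := by
  classical
  induction L generalizing j with
  | nil => exact ⟨Pi.single j 1, by simp +contextual, by simp [pivotProd],
      by simp [partialCov, Pi.single_apply]⟩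
  | cons s L ih =>
    obtain ⟨u, hu, huj, huK⟩ := ih j
    obtain ⟨w, hw, -, hwK⟩ := ih s
    refine ⟨partialCov K L s s • u - partialCov K L j s • w, fun v hv hvj => ?_, fun hj => ?_,
      fun k => ?_⟩
    · rw [List.mem_cons, not_or] at hv
      simp [hu v hv.2 hvj, hw v hv.2 hv.1]
    · rw [List.mem_cons, not_or] at hj
      simp [huj hj.2, hw j hj.2 hj.1, pivotProd]
    · simp only [Pi.sub_apply, Pi.smul_apply, smul_eq_mul, sub_mul, mul_assoc,
        Finset.sum_sub_distrib, ← Finset.mul_sum, huK, hwK, partialCov]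

/-- Conditional independence in the law of `A ε`, for an integer matrix `A`, can be read off from
the partial covariances. -/
lemma condIndepCoord_gaussianLaw_iff [Fintype V] {A : Matrix V V ℤ} {K : V → V → ℤ}
    (hK : A * A.transpose = Matrix.of K) {j k : V} {S : Finset V} {L : List V}
    (hL : ∀ v, v ∈ L ↔ v ∈ S) (hj : j ∉ S) (hpiv : pivotProd K L ≠ 0) :
    DCG.CondIndepCoord (gaussianLaw (A.map (Int.castRingHom ℝ))) j k S ↔
      partialCov K L j k = 0 := by
  set f := Int.castRingHom ℝ
  obtain ⟨u, hu, huj, huK⟩ := exists_residual (fun v w => f (K v w)) L j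
  have hp : f (pivotProd K L) ≠ 0 := by simpa [f] using hpiv
  have hcov : ∀ k, cov[fun x : V → ℝ => ((f (pivotProd K L))⁻¹ • u) ⬝ᵥ x, fun x => x k;
      gaussianLaw (A.map f)] = (f (pivotProd K L))⁻¹ * f (partialCov K L j k) := by
    intro k
    rw [covariance_dotProduct_left _ (memLp_two_eval k)]
    have h := huK k
    rw [partialCov_map] at h
    simp only [covariance_gaussianLaw, ← Matrix.transpose_map, ← Matrix.map_mul, Matrix.map_apply,
      hK, Matrix.of_apply, Pi.smul_apply, smul_eq_mul, mul_assoc, ← Finset.mul_sum, h]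
  rw [condIndepCoord_iff_covariance_eq_zero _ (u := (f (pivotProd K L))⁻¹ • u) hj, hcov]
  · simpa [f] using fun h => (hpiv h).elim
  · rw [Pi.smul_apply, huj (by rwa [hL]), pivotProd_map, smul_eq_mul, inv_mul_cancel₀ hp]
  · intro v hv hvj
    rw [Pi.smul_apply, hu v (by rwa [hL]) hvj, smul_zero]
  · intro s hs
    rw [hcov, partialCov_eq_zero_of_mem K ((hL s).2 hs), map_zero, mul_zero]

/-- The solution of `X = Bᵀ X + ε` is `A ε`, where `A` is the inverse of `1 - Bᵀ`. -/
lemma isGaussianLinear_gaussianLaw [Fintype V] [DecidableEq V] {G : DCG V}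
    {A : Matrix V V ℤ} {B : V → V → ℤ}
    (hB : ∀ j k, B j k ≠ 0 ↔ G.Adj j k) (hA : (1 - (Matrix.of B).transpose) * A = 1) :
    G.IsGaussianLinear (gaussianLaw (A.map (Int.castRingHom ℝ))) := by
  set f := Int.castRingHom ℝ
  have h : (1 - ((Matrix.of B).map f).transpose) * A.map f = 1 := by
    have := congrArg (fun M => M.map f) hA
    simpa [Matrix.map_mul, Matrix.map_sub, Matrix.transpose_map] using this
  refine ⟨(Matrix.of B).map f, fun j k => by simpa [f] using hB j k,
    Matrix.isUnit_det_of_right_inverse h, ?_⟩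
  rw [Matrix.inv_eq_right_inv h]
  rfl

end Elimination

/-! ### Two graphs with the same skeleton and nested d-separation rules -/

namespace DCG

/-- The graph with the feedback loop `0 ⇄ 1`, with `2 → 1` and `3 → 0`, and with `4` a common
cause of all other vertices. The vertices `2` and `3` enter the loop at different places. -/
def twoCauses : DCG (Fin 5) where
  Adj j k := (j, k) ∈ [((0 : Fin 5), (1 : Fin 5)), (1, 0), (2, 1), (3, 0), (4, 0), (4, 1), (4, 2),
    (4, 3)]
  irrefl := by decide

/-- The graph with the feedback loop `0 ⇄ 1`, with `2 → 0`, with `0 → 3 ← 1`, and with `4` a common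
cause of all other vertices. The vertex `2` is a cause of the loop and `3` is an effect. -/
def causeEffect : DCG (Fin 5) where
  Adj j k := (j, k) ∈ [((0 : Fin 5), (1 : Fin 5)), (1, 0), (0, 3), (1, 3), (2, 0), (4, 0), (4, 1),
    (4, 2), (4, 3)]
  irrefl := by decide

instance : DecidableRel twoCauses.Adj := fun j k =>
  inferInstanceAs (Decidable ((j, k) ∈ [((0 : Fin 5), (1 : Fin 5)), _, _, _, _, _, _, _]))

instance : DecidableRel causeEffect.Adj := fun j k =>
  inferInstanceAs (Decidable ((j, k) ∈ [((0 : Fin 5), (1 : Fin 5)), _, _, _, _, _, _, _, _]))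

lemma hasDirectedCycle_twoCauses : twoCauses.HasDirectedCycle :=
  ⟨0, .head (show twoCauses.Adj 0 1 by decide) (.single (show twoCauses.Adj 1 0 by decide))⟩

lemma hasDirectedCycle_causeEffect : causeEffect.HasDirectedCycle :=
  ⟨0, .head (show causeEffect.Adj 0 1 by decide) (.single (show causeEffect.Adj 1 0 by decide))⟩

/-- A decidable sufficient condition for adjacency in the skeleton. -/
lemma skeleton_adj_of_adj {V : Type*} {G : DCG V} {j k : V} (hjk : j ≠ k)
    (h : (G.Adj j k ∨ G.Adj k j) ∨ ∃ l, G.Adj j l ∧ G.Adj k l ∧ (G.Adj l j ∨ G.Adj l k)) :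
    G.skeleton.Adj j k :=
  ⟨hjk, h.imp id fun ⟨l, hj, hk, hl⟩ => ⟨l, hj, hk, hl.imp .single .single⟩⟩

lemma skeleton_adj_twoCauses {j k : Fin 5} (hjk : j ≠ k)
    (h' : ¬ (j = 2 ∧ k = 3 ∨ j = 3 ∧ k = 2)) : twoCauses.skeleton.Adj j k := by
  have h : ∀ j k : Fin 5, j ≠ k → ¬ (j = 2 ∧ k = 3 ∨ j = 3 ∧ k = 2) →
      (twoCauses.Adj j k ∨ twoCauses.Adj k j) ∨ ∃ l, twoCauses.Adj j l ∧ twoCauses.Adj k l ∧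
        (twoCauses.Adj l j ∨ twoCauses.Adj l k) := by decide +kernel
  exact skeleton_adj_of_adj hjk (h _ _ hjk h')

lemma skeleton_adj_causeEffect {j k : Fin 5} (hjk : j ≠ k)
    (h' : ¬ (j = 2 ∧ k = 3 ∨ j = 3 ∧ k = 2)) : causeEffect.skeleton.Adj j k := by
  have h : ∀ j k : Fin 5, j ≠ k → ¬ (j = 2 ∧ k = 3 ∨ j = 3 ∧ k = 2) →
      (causeEffect.Adj j k ∨ causeEffect.Adj k j) ∨ ∃ l, causeEffect.Adj j l ∧
        causeEffect.Adj k l ∧ (causeEffect.Adj l j ∨ causeEffect.Adj l k) := by decide +kernel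
  exact skeleton_adj_of_adj hjk (h _ _ hjk h')

/-- In `twoCauses` all pairs other than `{2, 3}` are adjacent, and `{2, 3}` is not an edge of the
skeleton of `causeEffect`. -/
lemma skeletonCard_causeEffect_le : causeEffect.skeletonCard ≤ twoCauses.skeletonCard := by
  refine skeletonCard_le_of_skeleton_le fun j k h => skeleton_adj_twoCauses h.1 fun h' => ?_
  have h₁ : ¬ causeEffect.ReallyAdjacent 2 3 ∧ ¬ causeEffect.ReallyAdjacent 3 2 := by
    unfold ReallyAdjacent; decide
  have h₂ : ∀ l, ¬ (causeEffect.Adj 2 l ∧ causeEffect.Adj 3 l) := by decide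
  rcases h' with ⟨rfl, rfl⟩ | ⟨rfl, rfl⟩ <;> rcases h.2 with h | ⟨l, hj, hk, -⟩
  · exact h₁.1 h
  · exact h₂ l ⟨hj, hk⟩
  · exact h₁.2 h
  · exact h₂ l ⟨hk, hj⟩

/-- The d-separation rules of `twoCauses`: given `4`, the vertices `2` and `3` are separated by the
empty set and by the whole loop `{0, 1}`, but not by one vertex of the loop. -/
lemma mem_Dsep_twoCauses_iff {j k : Fin 5} {S : Finset (Fin 5)} (hjk : j ≠ k) (hj : j ∉ S)
    (hk : k ∉ S) : (j, k, S) ∈ twoCauses.Dsep ↔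
      (j = 2 ∧ k = 3 ∨ j = 3 ∧ k = 2) ∧ 4 ∈ S ∧ (0 ∈ S ↔ 1 ∈ S) := by
  by_cases hp : j = 2 ∧ k = 3 ∨ j = 3 ∧ k = 2
  swap
  · exact iff_of_false
      (fun h => h.2.2.2 (dConnected_of_skeleton_adj (skeleton_adj_twoCauses hjk hp) S))
      fun h => hp h.1
  wlog h23 : j = 2 ∧ k = 3 generalizing j k
  · rw [mem_Dsep_comm, this hjk.symm hk hj (by tauto) (by tauto)]
    tauto
  obtain ⟨rfl, rfl⟩ := h23
  constructor
  · rintro ⟨-, -, -, h⟩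
    change ¬ twoCauses.DConnected 2 3 S at h
    refine ⟨by simp, ?_, ?_⟩
    · by_contra h4
      exact h ⟨.bwd (b := 4) (by decide) (.fwd (by decide) (.nil 3)), by decide +kernel,
        by simpa [Trail.Active] using h4⟩
    · by_contra h01
      have h01 : 0 ∈ S ∧ 1 ∉ S ∨ 1 ∈ S ∧ 0 ∉ S := by tauto
      rcases h01 with ⟨h0, h1⟩ | ⟨h1, h0⟩
      · exact h ⟨.fwd (b := 1) (by decide) (.fwd (b := 0) (by decide)
          (.bwd (by decide) (.nil 3))), by decide +kernel,
          by simp [Trail.Active, h1, mem_an_of_mem h0]⟩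
      · exact h ⟨.fwd (b := 1) (by decide) (.bwd (b := 0) (by decide)
          (.bwd (by decide) (.nil 3))), by decide +kernel,
          by simp [Trail.Active, h0, mem_an_of_mem h1]⟩
  · rintro ⟨-, h4, h01⟩
    refine ⟨hjk, hj, hk, ?_⟩
    have hS : ∀ S : Finset (Fin 5), 2 ∉ S → 3 ∉ S → 4 ∈ S → (0 ∈ S ↔ 1 ∈ S) →
      S = {4} ∨ S = {0, 1, 4} := by decide +kernel
    rcases hS S hj hk h4 h01 with rfl | rfl
    -- Given `4` alone, a trail from `2` circulates in the loop, as no collider is open.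
    · apply not_dConnected_of_invariant {4} {0, 1} {4} <;> decide +kernel
    -- Given the loop, a trail from `2` enters it at `1` and is blocked at the next vertex.
    · apply not_dConnected_of_invariant Finset.univ {1} {0, 2, 4} <;> decide +kernel

/-- In `causeEffect`, the paths `2 ← 4 → 3`, `2 → 0 → 3` and `2 → 0 ← 1 → 3` can only be blocked by
`{0, 1, 4}`. -/
lemma of_mem_Dsep_causeEffect {j k : Fin 5} {S : Finset (Fin 5)}
    (h : (j, k, S) ∈ causeEffect.Dsep) :
    (j = 2 ∧ k = 3 ∨ j = 3 ∧ k = 2) ∧ 0 ∈ S ∧ 1 ∈ S ∧ 4 ∈ S := by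
  by_cases hp : j = 2 ∧ k = 3 ∨ j = 3 ∧ k = 2
  swap
  · exact (h.2.2.2 (dConnected_of_skeleton_adj (skeleton_adj_causeEffect h.1 hp) S)).elim
  wlog h23 : j = 2 ∧ k = 3 generalizing j k
  · have := this (mem_Dsep_comm.1 h) (by tauto) (by tauto)
    tauto
  obtain ⟨rfl, rfl⟩ := h23
  obtain ⟨-, -, -, h⟩ := h
  change ¬ causeEffect.DConnected 2 3 S at h
  have h0 : 0 ∈ S := by
    by_contra h0
    exact h ⟨.fwd (b := 0) (by decide) (.fwd (by decide) (.nil 3)), by decide +kernel,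
      by simp [Trail.Active, h0]⟩
  refine ⟨by simp, h0, ?_, ?_⟩
  · by_contra h1
    exact h ⟨.fwd (b := 0) (by decide) (.bwd (b := 1) (by decide)
      (.fwd (by decide) (.nil 3))), by decide +kernel, by simp [Trail.Active, h1, mem_an_of_mem h0]⟩
  · by_contra h4
    exact h ⟨.bwd (b := 4) (by decide) (.fwd (by decide) (.nil 3)), by decide +kernel,
      by simp [Trail.Active, h4]⟩

lemma Dsep_causeEffect_ssubset : causeEffect.Dsep ⊂ twoCauses.Dsep := by
  refine ⟨?_, fun h => ?_⟩
  · rintro ⟨j, k, S⟩ hS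
    obtain ⟨hjk, h0, h1, h4⟩ := of_mem_Dsep_causeEffect hS
    exact (mem_Dsep_twoCauses_iff hS.1 hS.2.1 hS.2.2.1).2 ⟨hjk, h4, by simp [h0, h1]⟩
  · have h' := h ((mem_Dsep_twoCauses_iff (j := 2) (k := 3) (S := {4}) (by decide) (by decide)
      (by decide)).2 (by decide))
    exact absurd (of_mem_Dsep_causeEffect h').2.1 (by decide)

/-! ### Gaussian distributions on the two graphs -/

/-- The elements of `S` in increasing order. -/
def toList (S : Finset (Fin 5)) : List (Fin 5) := (List.finRange 5).filter (· ∈ S)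

lemma condIndepCoord_gaussianLaw_iff_toList {A : Matrix (Fin 5) (Fin 5) ℤ}
    {K : Fin 5 → Fin 5 → ℤ} (hK : A * A.transpose = Matrix.of K)
    (hpiv : ∀ S, pivotProd K (toList S) ≠ 0) {j : Fin 5} (k : Fin 5) {S : Finset (Fin 5)}
    (hj : j ∉ S) :
    CondIndepCoord (gaussianLaw (A.map (Int.castRingHom ℝ))) j k S ↔
      partialCov K (toList S) j k = 0 :=
  condIndepCoord_gaussianLaw_iff hK (by simp [toList]) hj (hpiv S)

lemma cfc_twoCauses_gaussianLaw {A : Matrix (Fin 5) (Fin 5) ℤ}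
    {K : Fin 5 → Fin 5 → ℤ} (hK : A * A.transpose = Matrix.of K)
    (hpiv : ∀ S, pivotProd K (toList S) ≠ 0)
    (h : ∀ (S : Finset (Fin 5)) (j k : Fin 5), j ≠ k → j ∉ S → k ∉ S →
      (partialCov K (toList S) j k = 0 ↔
        (j = 2 ∧ k = 3 ∨ j = 3 ∧ k = 2) ∧ 4 ∈ S ∧ (0 ∈ S ↔ 1 ∈ S))) :
    twoCauses.CFC (gaussianLaw (A.map (Int.castRingHom ℝ))) := fun j k S hjk hj hk => by
  rw [mem_Dsep_twoCauses_iff hjk hj hk, condIndepCoord_gaussianLaw_iff_toList hK hpiv k hj,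
    h S j k hjk hj hk]

/-- A Gaussian linear model on `twoCauses` that is faithful. -/
lemma exists_isGaussianLinear_twoCauses :
    ∃ P, twoCauses.IsGaussianLinear P ∧ twoCauses.CFC P := by
  refine ⟨_, isGaussianLinear_gaussianLaw
    (A := !![-1, -1, -1, -1, -3; -2, -1, -1, -2, -6; 0, 0, 1, 0, 1; 0, 0, 0, 1, 1; 0, 0, 0, 0, 1])
    (B := ![![0, 2, 0, 0, 0], ![1, 0, 0, 0, 0], ![0, 1, 0, 0, 0],
      ![1, 0, 0, 0, 0], ![2, -1, 1, 1, 0]])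
    (by decide +kernel) (by decide +kernel),
    cfc_twoCauses_gaussianLaw (K := ![![13, 24, -4, -4, -3], ![24, 46, -7, -8, -6],
      ![-4, -7, 2, 1, 1], ![-4, -8, 1, 2, 1], ![-3, -6, 1, 1, 1]]) (by decide +kernel)
      (by decide +kernel) (by decide +kernel)⟩

/-- A Gaussian linear model on `causeEffect` that is faithful to `twoCauses`: the edge `0 → 3`
cancels the effect of `2` on `3` along `2 → 0 → 1 → 3`. -/
lemma exists_isGaussianLinear_causeEffect :
    ∃ P, causeEffect.IsGaussianLinear P ∧ twoCauses.CFC P := by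
  refine ⟨_, isGaussianLinear_gaussianLaw
    (A := !![-1, -2, -2, 0, -6; -1, -1, -2, 0, -5; 0, 0, 1, 0, 1; 0, 1, 0, 1, 2; 0, 0, 0, 0, 1])
    (B := ![![0, 1, 0, -1, 0], ![2, 0, 0, 1, 0], ![2, 0, 0, 0, 0],
      ![0, 0, 0, 0, 0], ![2, 1, 1, 1, 0]])
    (by decide +kernel) (by decide +kernel),
    cfc_twoCauses_gaussianLaw (K := ![![45, 37, -8, -14, -6], ![37, 31, -7, -11, -5],
      ![-8, -7, 2, 2, 1], ![-14, -11, 2, 6, 2], ![-6, -5, 1, 2, 1]]) (by decide +kernel)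
      (by decide +kernel) (by decide +kernel)⟩

/-- The law of a vector in which `2 → 0 → 3` is a Markov chain, independent of `1` and `4`, is
Markov to `causeEffect` but not to `twoCauses`. -/
lemma exists_cmc_causeEffect_not_cmc_twoCauses :
    ∃ P, causeEffect.CMC P ∧ ¬ twoCauses.CMC P := by
  let A : Matrix (Fin 5) (Fin 5) ℤ :=
    !![1, 0, 1, 0, 0; 0, 1, 0, 0, 0; 0, 0, 1, 0, 0; 1, 0, 1, 1, 0; 0, 0, 0, 0, 1]
  let K : Fin 5 → Fin 5 → ℤ :=
    ![![2, 0, 1, 2, 0], ![0, 1, 0, 0, 0], ![1, 0, 1, 1, 0], ![2, 0, 1, 3, 0], ![0, 0, 0, 0, 1]]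
  have hK : A * A.transpose = Matrix.of K := by decide +kernel
  have hpiv : ∀ S, pivotProd K (toList S) ≠ 0 := by decide +kernel
  refine ⟨_, fun j k S hS => (condIndepCoord_gaussianLaw_iff_toList hK hpiv k hS.2.1).2 ?_,
    fun h => ?_⟩
  · have hsep : ∀ (S : Finset (Fin 5)) (j k : Fin 5), j ∉ S → k ∉ S →
        (j = 2 ∧ k = 3 ∨ j = 3 ∧ k = 2) ∧ 0 ∈ S ∧ 1 ∈ S ∧ 4 ∈ S →
        partialCov K (toList S) j k = 0 := by decide +kernel
    exact hsep S j k hS.2.1 hS.2.2.1 (of_mem_Dsep_causeEffect hS)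
  · have h' := h 2 3 {4} ((mem_Dsep_twoCauses_iff (by decide) (by decide) (by decide)).2
      (by decide))
    rw [condIndepCoord_gaussianLaw_iff_toList hK hpiv 3 (by decide)] at h'
    exact absurd h' (by decide +kernel)

lemma causeEffect_notMem_mec : causeEffect ∉ twoCauses.mec := fun h => by
  obtain ⟨P, h₁, h₂⟩ := exists_cmc_causeEffect_not_cmc_twoCauses
  exact h₂ ((h P).2 h₁)

lemma twoCauses_notMem_mec : twoCauses ∉ causeEffect.mec := fun h =>
  causeEffect_notMem_mec fun P => (h P).symm

lemma cmc_causeEffect {P : ProbabilityMeasure (Fin 5 → ℝ)} (h : twoCauses.CMC P) :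
    causeEffect.CMC P := fun j k S hS => h j k S (Dsep_causeEffect_ssubset.1 hS)

end DCG

end

theorem mainTheorem2 :
    -- the CFC implies the weak SMR assumption
    (∀ (V : Type*) [Fintype V] (G : DCG V) (P : ProbabilityMeasure (V → ℝ)),
      G.CFC P → G.WeakSMR P) ∧
    -- a faithful model violating the identifiable SMR assumption
    (∃ (G : DCG (Fin 5)) (P : ProbabilityMeasure (Fin 5 → ℝ)),
      G.HasDirectedCycle ∧ G.IsGaussianLinear P ∧ G.CFC P ∧ ¬ G.IdentifiableSMR P) ∧
    -- the identifiable SMR assumption implies the P-minimality assumption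
    (∀ (V : Type*) [Fintype V] (G : DCG V) (P : ProbabilityMeasure (V → ℝ)),
      G.IdentifiableSMR P → G.PMinimal P) ∧
    -- a model satisfying the weak SMR assumption but not the P-minimality assumption
    (∃ (G : DCG (Fin 5)) (P : ProbabilityMeasure (Fin 5 → ℝ)),
      G.HasDirectedCycle ∧ G.IsGaussianLinear P ∧ G.WeakSMR P ∧ ¬ G.PMinimal P) := by
  refine ⟨fun V _ G P h => h.weakSMR, ?_, fun V _ G P h => h.pMinimal, ?_⟩
  · obtain ⟨P, hP, hcfc⟩ := DCG.exists_isGaussianLinear_twoCauses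
    refine ⟨DCG.twoCauses, P, DCG.hasDirectedCycle_twoCauses, hP, hcfc, fun h => ?_⟩
    exact (h.2 _ (DCG.cmc_causeEffect hcfc.cmc) DCG.causeEffect_notMem_mec).not_ge
      DCG.skeletonCard_causeEffect_le
  · obtain ⟨P, hP, hcfc⟩ := DCG.exists_isGaussianLinear_causeEffect
    refine ⟨DCG.causeEffect, P, DCG.hasDirectedCycle_causeEffect, hP,
      ⟨DCG.cmc_causeEffect hcfc.cmc, fun G' hG' _ =>
        DCG.skeletonCard_causeEffect_le.trans (hcfc.skeletonCard_le hG')⟩, fun h => ?_⟩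
    exact h.2 _ hcfc.cmc ⟨DCG.twoCauses_notMem_mec, DCG.Dsep_causeEffect_ssubset⟩
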